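/- **Words.** For a binary sequence $b=b_0b_1b_2\cdots\in\{0,1\}^{\mathbb N}$, a finite word $u$ is a *recurrent factor* of $b$ if it occurs in $b$ as a contiguous factor at infinitely many positions; $q_b(n)$ denotes the number of distinct recurrent factors of $b$ of length $n$ (the recurrent complexity of $b$). **Gridded permutations.** A ($2\times2$) gridded permutation of length $n$ is a permutation of $\{1,\dots,n\}$ whose plot is divided by one vertical and one horizontal line; two such are equal if the permutations are equal and the corresponding cells contain the same points. It is contained in a set of points of the plane, gridded by the coordinate axes, if its plot is order isomorphic to a finite subset of that set by a correspondence that sends the points of each cell to points of the corresponding quadrant. **Pin sequences and pin classes.** A pin sequence is an infinite word $w=w_0w_1w_2\cdots$ over the alphabet $\{\mathsf l_{\mathsf u},\mathsf l_{\mathsf d},\mathsf r_{\mathsf u},\mathsf r_{\mathsf d},\mathsf u_{\mathsf l},\mathsf u_{\mathsf r},\mathsf d_{\mathsf l},\mathsf d_{\mathsf r}\}$ in which the subscript of each $w_{i+1}$ is the main letter of $w_i$; the letters $\mathsf l,\mathsf r,\mathsf u,\mathsf d$ stand for left, right, up, down. It defines an infinite gridded permutation $\pi_w$ with points $p_0,p_1,\dots$: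 the point $p_0$ lies in the quadrant between the two directions of the letter $w_0$; for $i\ge1$, the point $p_i$ lies outside the rectangular hull of the origin and $p_0,\dots,p_{i-1}$, beyond it in the direction of the main letter of $w_i$, and its other coordinate separates $p_{i-1}$ from the origin and $p_0,\dots,p_{i-2}$. The pin class $\mathcal C_w$ is the set of all finite gridded permutations contained in $\pi_w$. For a binary sequence $b$, let $\phi(b)$ be the pin sequence obtained by replacing each $0$ of $b$ by $\mathsf l_{\mathsf u}\mathsf u_{\mathsf l}$ and each $1$ by $\mathsf r_{\mathsf u}\mathsf u_{\mathsf r}$. **Growth rates.** The growth rate of a class $\mathcal C$ with $|\mathcal C_n|$ members of length $n$ is $\mathrm{gr}(\mathcal C)=\lim_{n\to\infty}|\mathcal C_n|^{1/n}$, when this limit exists. Let $\mu\approx3.28277$ be the largest real zero of $z^5-4z^4+3z^3-2z^2-z+2$. **Proposition.** Let $b$ be a binary sequence for which $q_b(n)>n+1$ for some $n$. Then the growth rate $\mathrm{gr}(\mathcal C_{\phi(b)})$ exists and $\mathrm{gr}(\mathcal C_{\phi(b)})\ge\mu$. -/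

import Mathlib

namespace PinClasses

/-! ### Combinatorics on words -/

/-- The recurrent factors of length `n` of the infinite word `w` (indexed from `0`): the words
`u` of length `n` that occur in `w` at infinitely many positions. -/
def recurrentFactors {A : Type} (w : ℕ → A) (n : ℕ) : Set (Fin n → A) :=
  {u | {i : ℕ | ∀ j : Fin n, w (i + j) = u j}.Infinite}

/-- The recurrent complexity `q_w(n)`: the number of distinct recurrent factors of length `n`. -/
noncomputable def recurrentComplexity {A : Type} (w : ℕ → A) (n : ℕ) : ℕ :=
  (recurrentFactors w n).ncard

/-! ### Gridded permutations -/

/-- A permutation of length `n` in the `2 × 2` gridded plane. The plot of `perm` is divided by one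
vertical line, with exactly `vline` points to its left, and one horizontal line, with exactly
`hline` points below it. (Two placements of the lines give the same gridded permutation exactly
when every cell contains the same points, that is, when these two numbers agree.) -/
@[ext] structure GriddedPerm (n : ℕ) where
  perm : Equiv.Perm (Fin n)
  vline : Fin (n + 1)
  hline : Fin (n + 1)

instance (n : ℕ) : Finite (GriddedPerm n) :=
  Finite.of_injective
    (fun s : GriddedPerm n => (s.perm, s.vline, s.hline))
    (fun s t h => by
      simp only [Prod.mk.injEq] at h
      exact GriddedPerm.ext h.1 h.2.1 h.2.2)

/-- The gridded permutation `s` is contained in the gridded point set `{p 0, p 1, …}`, the plane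
being gridded by the two coordinate axes: there are points `p (f 0), …, p (f (n - 1))`, listed from
left to right, which are order isomorphic to the plot of `s.perm` and which lie in the same cells
as the corresponding points of `s`. -/
def GriddedPerm.ContainedIn {n : ℕ} (s : GriddedPerm n) (p : ℕ → ℤ × ℤ) : Prop :=
  ∃ f : Fin n → ℕ,
    (∀ i j, i < j → (p (f i)).1 < (p (f j)).1) ∧
    (∀ i j, s.perm i < s.perm j ↔ (p (f i)).2 < (p (f j)).2) ∧
    (∀ i : Fin n, (i : ℕ) < s.vline ↔ (p (f i)).1 < 0) ∧
    (∀ i : Fin n, (s.perm i : ℕ) < s.hline ↔ (p (f i)).2 < 0)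

/-! ### Pin sequences -/

/-- The four directions of a pin. -/
inductive Dir
  | left
  | right
  | up
  | down

/-- Whether a direction is horizontal. -/
def Dir.isHorizontal : Dir → Bool
  | .left => true
  | .right => true
  | .up => false
  | .down => false

/-- The unit vector in a given direction. -/
def Dir.vec : Dir → ℤ × ℤ
  | .left => (-1, 0)
  | .right => (1, 0)
  | .up => (0, 1)
  | .down => (0, -1)

/-- The eight letters `l_u, l_d, r_u, r_d, u_l, u_r, d_l, d_r` of the memory encoding: a direction
`dir`, and as a subscript the perpendicular direction `mem` of the previous pin. -/
structure PinLetter where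
  dir : Dir
  mem : Dir
  perp : dir.isHorizontal ≠ mem.isHorizontal

/-- An infinite pin word (pin sequence): the subscript of each letter is the direction of the
letter before it. -/
structure PinSequence where
  letter : ℕ → PinLetter
  chain : ∀ i, (letter (i + 1)).mem = (letter i).dir

/-- The points of the infinite gridded permutation `π_w` (the first one has index `0`). The `i`-th
pin lies at distance `2 * i + 4` from the origin in its own direction, which puts it outside the
rectangular hull of the origin and the earlier pins (whose coordinates are at most `2 * i + 2` in
absolute value). Its other coordinate has size `2 * i + 1` in the direction of the previous pin,
which separates the previous pin (at distance `2 * i + 2` in that direction) from the origin and all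
earlier pins (at distance at most `2 * i` in that direction). The first pin lies in the quadrant
between the two directions of its letter. -/
def PinSequence.point (w : PinSequence) (i : ℕ) : ℤ × ℤ :=
  (2 * (i : ℤ) + 4) • (w.letter i).dir.vec + (2 * (i : ℤ) + 1) • (w.letter i).mem.vec

/-- The pin class `C_w`, by length: the gridded permutations of length `n` contained in `π_w`. -/
def pinClass (w : PinSequence) (n : ℕ) : Set (GriddedPerm n) :=
  {s | s.ContainedIn w.point}

/-! ### Pin sequences from binary words -/

/-- The horizontal direction given by a binary digit: `0` (`false`) is left, `1` (`true`) is
right. -/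
def Dir.ofBit : Bool → Dir
  | false => .left
  | true => .right

/-- The two-quadrant pin sequence `φ(b)` of a binary sequence `b`, obtained by replacing each `0` by
`l_u u_l` and each `1` by `r_u u_r`. -/
def phi (b : ℕ → Bool) : PinSequence where
  letter i :=
    if i % 2 = 0 then
      ⟨Dir.ofBit (b (i / 2)), .up, by cases b (i / 2) <;> decide⟩
    else
      ⟨.up, Dir.ofBit (b (i / 2)), by cases b (i / 2) <;> decide⟩
  chain i := by
    rcases Nat.mod_two_eq_zero_or_one i with h | h
    · have h1 : (i + 1) % 2 = 1 := by omega
      have h2 : (i + 1) / 2 = i / 2 := by omega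
      simp [h, h1, h2]
    · have h1 : (i + 1) % 2 = 0 := by omega
      simp [h, h1]

/-! ### Growth rates -/

/-- The sequence `s` has growth rate `g`: the upper and lower limits of the `n`-th roots of `s n`
both equal `g`. -/
def HasGrowthRate (s : ℕ → ℕ) (g : ℝ) : Prop :=
  Filter.Tendsto (fun n : ℕ => (s n : ℝ) ^ (1 / (n : ℝ))) Filter.atTop (nhds g)

/-- The real zeros of `z^5 - 4z^4 + 3z^3 - 2z^2 - z + 2`. -/
def muZeros : Set ℝ :=
  {z | z ^ 5 - 4 * z ^ 4 + 3 * z ^ 3 - 2 * z ^ 2 - z + 2 = 0}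

/-- The constant `μ ≈ 3.28277`: the largest real zero of `z^5 - 4z^4 + 3z^3 - 2z^2 - z + 2`. -/
noncomputable def mu : ℝ := sSup muZeros

/-- `mu` is indeed the largest element of `muZeros`. -/
theorem mu_isGreatest : IsGreatest muZeros mu := by
  have hne : muZeros.Nonempty := by
    have hc : ContinuousOn
        (fun z : ℝ => z ^ 5 - 4 * z ^ 4 + 3 * z ^ 3 - 2 * z ^ 2 - z + 2) (Set.Icc 3 4) := by
      fun_prop
    obtain ⟨z, -, hz⟩ := intermediate_value_Icc (by norm_num) hc
      (show (0 : ℝ) ∈ Set.Icc _ _ by constructor <;> norm_num)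
    exact ⟨z, hz⟩
  have hbd : BddAbove muZeros := by
    refine ⟨4, fun z hz => ?_⟩
    have hz' : z ^ 5 - 4 * z ^ 4 + 3 * z ^ 3 - 2 * z ^ 2 - z + 2 = 0 := hz
    by_contra h
    have h4 : 0 < z - 4 := by linarith [not_le.mp h]
    have e : z ^ 5 - 4 * z ^ 4 + 3 * z ^ 3 - 2 * z ^ 2 - z + 2
        = z ^ 4 * (z - 4) + 2 * z ^ 2 * (z - 4) + z ^ 3 + 6 * z ^ 2 - z + 2 := by ring
    have hz0 : 0 < z := by linarith
    have : 0 < z ^ 4 * (z - 4) := by positivity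
    have : 0 < z ^ 2 * (z - 4) := by positivity
    have : 0 < z ^ 3 := by positivity
    nlinarith
  have hcl : IsClosed muZeros :=
    isClosed_eq (by fun_prop) continuous_const
  exact ⟨hcl.csSup_mem hne hbd, fun z hz => le_csSup hbd hz⟩

end PinClasses

/-! All pins of `phi b` lie above the horizontal axis, so a finite set of pins is determined as a
gridded permutation by the sides of its points, listed from the top down, and by the horizontal
order on each side. Height and distance from the axis both follow the index up to swaps of
neighbours. The two orders therefore disagree ("cross") only for consecutive pins on one side, and
such pins are at most three places apart in the list. Hence the class is counted by words over a
finite alphabet, the codes (`ncard_pinClass`).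

A letter of a code sees only three places ahead, so cutting a code loses a bounded amount of
information. The counts are submultiplicative up to a constant, and Fekete's lemma gives the growth
rate.

For the lower bound, consider codes realised arbitrarily far out. They are closed under
concatenation, and an indecomposable block at the front is uniquely determined, so their counts `r`
satisfy `r n ≥ ∑ B i * r (n - i)`, where `B` counts the recurrent indecomposable blocks
(`sum_le_ncard_recurrentCodes`). Contiguous factors of the pin sequence supply blocks: the two
parities of the starting pin give `B n ≥ q ((n + 1) / 2) + q ((n + 2) / 2)` for `n ≥ 4`, with
separate bounds for `n ≤ 3`. If `q n = n + 1`, the generating function of these bounds equals 1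
exactly at `1 / μ`. One excess of `q` pushes it strictly above 1 (`one_lt_blockBound`). A finite
partial sum then already reaches 1, and the recurrence forces `r n ≥ c * μ ^ n`. -/

namespace PinClasses

/-! ### Recurrent complexity -/

section Complexity

variable {A : Type} (w : ℕ → A)

theorem init_mem_recurrentFactors {n : ℕ} {u : Fin (n + 1) → A}
    (hu : u ∈ recurrentFactors w (n + 1)) : Fin.init u ∈ recurrentFactors w n := by
  refine Set.Infinite.mono ?_ hu
  intro i hi j
  simpa [Fin.init] using hi j.castSucc

theorem tail_mem_recurrentFactors {n : ℕ} {u : Fin (n + 1) → A}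
    (hu : u ∈ recurrentFactors w (n + 1)) : Fin.tail u ∈ recurrentFactors w n := by
  have h : ((fun i => i + 1) '' {i : ℕ | ∀ j : Fin (n + 1), w (i + j) = u j}).Infinite :=
    Set.Infinite.image (Set.injOn_of_injective (add_left_injective 1)) hu
  refine h.mono ?_
  rintro _ ⟨i, hi, rfl⟩ j
  have := hi j.succ
  simpa [Fin.tail, add_assoc, add_comm, add_left_comm] using this

/-- Pigeonhole: infinitely many occurrences are shared among finitely many next letters. -/
theorem exists_extension [Finite A] {n : ℕ} {u : Fin n → A} (hu : u ∈ recurrentFactors w n) :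
    ∃ v ∈ recurrentFactors w (n + 1), Fin.init v = u := by
  have hu' : {i : ℕ | ∀ j : Fin n, w (i + j) = u j}.Infinite := hu
  by_contra! h
  refine hu' ?_
  have : {i : ℕ | ∀ j : Fin n, w (i + j) = u j} ⊆
      ⋃ a : A, {i : ℕ | ∀ j : Fin (n + 1), w (i + j) = (Fin.snoc u a : Fin (n + 1) → A) j} := by
    intro i hi
    refine Set.mem_iUnion.2 ⟨w (i + n), fun j => ?_⟩
    induction j using Fin.lastCases with
    | last => simp
    | cast j => simpa using hi j
  refine Set.Finite.subset (Set.finite_iUnion fun a => ?_) this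
  by_contra hinf
  exact h _ hinf (Fin.init_snoc _ _)

theorem recurrentComplexity_le_succ [Finite A] (n : ℕ) :
    recurrentComplexity w n ≤ recurrentComplexity w (n + 1) := by
  have h : recurrentFactors w n ⊆ Fin.init '' recurrentFactors w (n + 1) := by
    intro u hu
    obtain ⟨v, hv, rfl⟩ := exists_extension w hu
    exact ⟨v, hv, rfl⟩
  exact (Set.ncard_le_ncard h (Set.toFinite _)).trans (Set.ncard_image_le (Set.toFinite _))

theorem recurrentComplexity_mono [Finite A] : Monotone (recurrentComplexity w) :=
  monotone_nat_of_le_succ (recurrentComplexity_le_succ w)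

/-- If the recurrent complexity does not grow at one step, then it does not grow at the next. -/
theorem recurrentComplexity_stable_succ [Finite A] {n : ℕ}
    (h : recurrentComplexity w (n + 1) ≤ recurrentComplexity w n) :
    recurrentComplexity w (n + 2) ≤ recurrentComplexity w (n + 1) := by
  have himg : ∀ m, Fin.init '' recurrentFactors w (m + 1) = recurrentFactors w m := by
    intro m
    ext u
    constructor
    · rintro ⟨v, hv, rfl⟩
      exact init_mem_recurrentFactors w hv
    · intro hu
      obtain ⟨v, hv, rfl⟩ := exists_extension w hu
      exact ⟨v, hv, rfl⟩
  -- Equal counts make the surjection `Fin.init` injective: each recurrent factor of length `n` has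
  -- a unique recurrent right extension. Applied to tails, this passes to the next length.
  have hinj : Set.InjOn (Fin.init : (Fin (n + 1) → A) → (Fin n → A))
      (recurrentFactors w (n + 1)) := by
    apply Set.injOn_of_ncard_image_eq _ (Set.toFinite _)
    rw [himg]
    exact le_antisymm (recurrentComplexity_le_succ w n) h
  refine Set.ncard_le_ncard_of_injOn Fin.init
    (fun v hv => init_mem_recurrentFactors w hv) ?_ (Set.toFinite _)
  intro v hv v' hv' hvv
  have ht : Fin.tail v = Fin.tail v' := by
    apply hinj (tail_mem_recurrentFactors w hv) (tail_mem_recurrentFactors w hv')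
    funext j
    exact congrFun hvv j.succ
  funext j
  induction j using Fin.cases with
  | zero => exact congrFun hvv 0
  | succ j => exact congrFun ht j

theorem recurrentComplexity_stable [Finite A] {n : ℕ}
    (h : recurrentComplexity w (n + 1) ≤ recurrentComplexity w n) (k : ℕ) :
    recurrentComplexity w (n + k) ≤ recurrentComplexity w n := by
  have step : ∀ k, recurrentComplexity w (n + k + 1) ≤ recurrentComplexity w (n + k) := by
    intro k
    induction k with
    | zero => exact h
    | succ k ih => exact recurrentComplexity_stable_succ w ih
  induction k with
  | zero => rfl
  | succ k ih => exact (step k).trans ih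

theorem recurrentComplexity_zero : recurrentComplexity w 0 = 1 := by
  have : recurrentFactors w 0 = Set.univ := by
    ext u
    simp [recurrentFactors, Set.infinite_univ]
  rw [recurrentComplexity, this, Set.ncard_univ, Nat.card_unique]

end Complexity

/-- If `q_b(n) > n + 1` for some `n`, then `q_b` grows at least as fast as the complexity of a
Sturmian word up to a first place `N` where it exceeds it, and does not decrease from there on. -/
theorem exists_first_excess (b : ℕ → Bool) (hb : ∃ n, recurrentComplexity b n > n + 1) :
    ∃ N, 2 ≤ N ∧ (∀ n < N, n + 1 ≤ recurrentComplexity b n) ∧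
      ∀ n, N ≤ n → N + 2 ≤ recurrentComplexity b n := by
  classical
  let N := Nat.find hb
  have hN : N + 1 < recurrentComplexity b N := Nat.find_spec hb
  have hlt : ∀ m < N, recurrentComplexity b m ≤ m + 1 := fun m hm =>
    not_lt.1 (Nat.find_min hb hm)
  have hstep : ∀ m < N, recurrentComplexity b m < recurrentComplexity b (m + 1) := by
    intro m hm
    -- A stall at `m < N` would freeze the complexity at a value at most `m + 1`, below its value at
    -- `N`.
    by_contra! h
    have h1 := recurrentComplexity_stable b h (N - m)
    rw [Nat.add_sub_cancel' hm.le] at h1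
    have := hlt m hm
    omega
  have hlow : ∀ m ≤ N, m + 1 ≤ recurrentComplexity b m := by
    intro m hm
    induction m with
    | zero => rw [recurrentComplexity_zero]
    | succ m ih =>
      have h1 := ih (by omega)
      have h2 := hstep m (by omega)
      omega
  refine ⟨N, ?_, fun n hn => hlow n hn.le, fun n hn => ?_⟩
  -- There are only `2 ^ N` binary words, which leaves no room for an excess at `N = 0` or `N = 1`.
  · by_contra! h
    have hc : recurrentComplexity b N ≤ 2 ^ N := by
      have := Set.ncard_le_card (recurrentFactors b N)
      simpa [recurrentComplexity] using this
    interval_cases N <;> simp at hc hN <;> omega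
  · have := recurrentComplexity_mono b hn
    omega

/-! ### Codes of finite sets of pins -/

/-- The distance of the `p`-th pin of `φ(b)` from the vertical axis. -/
def pinX (p : ℕ) : ℕ := if p % 2 = 0 then 2 * p + 4 else 2 * p + 1

/-- The height of the `p`-th pin of `φ(b)`. -/
def pinY (p : ℕ) : ℕ := if p % 2 = 0 then 2 * p + 1 else 2 * p + 4

/-- The signed first coordinate of the `p`-th pin of `φ(b)`. -/
def pinAbscissa (b : ℕ → Bool) (p : ℕ) : ℤ := if b (p / 2) then pinX p else -pinX p

theorem phi_point (b : ℕ → Bool) (p : ℕ) :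
    (phi b).point p = (pinAbscissa b p, (pinY p : ℤ)) := by
  rcases Nat.mod_two_eq_zero_or_one p with h | h <;> cases hb : b (p / 2) <;>
    simp [PinSequence.point, phi, h, hb, Dir.ofBit, Dir.vec, pinAbscissa, pinX, pinY]

/-- A horizontal (even) pin separates its vertical predecessor from everything earlier, so it lies
just below that predecessor. This is the only inversion between height and index. -/
theorem pinY_lt_iff (p q : ℕ) :
    pinY p < pinY q ↔ (p < q ∧ ¬ (p % 2 = 1 ∧ q = p + 1)) ∨ (p % 2 = 0 ∧ p = q + 1) := by
  unfold pinY
  split_ifs <;> omega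

theorem pinX_injective : Function.Injective pinX := by
  intro p q h
  unfold pinX at h
  split_ifs at h <;> omega

/-- For a pin `p` above a pin `q`: they lie in the same quadrant, and `p` is the closer of the two
to the vertical axis. -/
def crosses (b : ℕ → Bool) (p q : ℕ) : Bool :=
  (b (p / 2) == b (q / 2)) && decide (pinX p < pinX q)

/-- Only neighbouring indices can be ordered differently by `pinX` and `pinY`. The vertical (odd)
pin of such a pair is both the higher and the inner one. -/
theorem crosses_iff {b : ℕ → Bool} {p q : ℕ} (h : pinY q < pinY p) :
    crosses b p q = true ↔ b (p / 2) = b (q / 2) ∧ p % 2 = 1 ∧ (p = q + 1 ∨ q = p + 1) := by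
  rw [pinY_lt_iff] at h
  rw [crosses, Bool.and_eq_true, beq_iff_eq, decide_eq_true_eq]
  refine and_congr_right fun _ => ?_
  unfold pinX
  split_ifs <;> omega

/-- The code of one pin in a list: its quadrant, and which of the next three pins it crosses. -/
abbrev CodeLetter := Bool × (Fin 3 → Bool)

/-- The code of the pin `p` in front of the list `l`. -/
def pinCode (b : ℕ → Bool) (p : ℕ) (l : List ℕ) : CodeLetter :=
  (b (p / 2), fun i => (l[(i : ℕ)]?).any (crosses b p))

/-- The code of a list of pins. -/
def code (b : ℕ → Bool) : List ℕ → List CodeLetter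
  | [] => []
  | p :: l => pinCode b p l :: code b l

/-- The pins in the list are listed from the top down. -/
def Descending (l : List ℕ) : Prop := l.Pairwise fun p q => pinY q < pinY p

@[simp] theorem code_nil (b : ℕ → Bool) : code b [] = [] := rfl

@[simp] theorem code_cons (b : ℕ → Bool) (p : ℕ) (l : List ℕ) :
    code b (p :: l) = pinCode b p l :: code b l := rfl

@[simp] theorem length_code (b : ℕ → Bool) (l : List ℕ) : (code b l).length = l.length := by
  induction l with
  | nil => rfl
  | cons p l ih => simp [ih]

theorem getElem_code (b : ℕ → Bool) (l : List ℕ) (i : ℕ) (h : i < l.length) :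
    (code b l)[i]'(by simpa using h) = pinCode b l[i] (l.drop (i + 1)) := by
  induction l generalizing i with
  | nil => simp at h
  | cons p l ih =>
    cases i with
    | zero => simp
    | succ i => simpa using ih i (by simpa using h)

/-- A pin crosses only pins at most three places after it in a descending list. -/
theorem lt_three_of_crosses {b : ℕ → Bool} {l : List ℕ} (hl : Descending l) {i k : ℕ}
    (h : i + 1 + k < l.length) (hc : crosses b l[i] l[i + 1 + k] = true) : k < 3 := by
  have key : ∀ (x y : ℕ) (hx : x < l.length) (hy : y < l.length), x < y →
      pinY l[y] < pinY l[x] := fun x y hx hy hxy => List.pairwise_iff_getElem.1 hl x y hx hy hxy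
  by_contra! hk
  -- For `p` odd the heights descend in the order `p`, `p + 1`, `p - 2`, `p - 1`, so at most two
  -- pins fit between `p` and a pin it crosses. Three intermediate pins contradict this.
  have h1 := key i (i + 1) (by omega) (by omega) (by omega)
  have h2 := key (i + 1) (i + 2) (by omega) (by omega) (by omega)
  have h3 := key (i + 2) (i + 3) (by omega) (by omega) (by omega)
  have h4 := key (i + 3) (i + 1 + k) (by omega) (by omega) (by omega)
  obtain ⟨-, ho, hq⟩ := (crosses_iff (by omega)).1 hc
  generalize l[i] = p at *
  generalize l[i + 1 + k] = q at *
  generalize l[i + 1] = x at *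
  generalize l[i + 2] = y at *
  generalize l[i + 3] = z at *
  rw [pinY_lt_iff] at h1 h2 h3 h4
  omega

/-- Whether a code says that the pin at place `i` crosses the pin at place `i + 1 + k`. -/
def codeCrosses (w : List CodeLetter) (i k : ℕ) : Bool :=
  if h : k < 3 then (w[i]?).any fun a => a.2 ⟨k, h⟩ else false

theorem crosses_eq_codeCrosses {b : ℕ → Bool} {l : List ℕ} (hl : Descending l) {i k : ℕ}
    (h : i + 1 + k < l.length) :
    crosses b l[i] l[i + 1 + k] = codeCrosses (code b l) i k := by
  unfold codeCrosses
  split_ifs with hk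
  · have hi : i < (code b l).length := by simp; omega
    rw [List.getElem?_eq_getElem hi, getElem_code b l i (by omega)]
    simp [pinCode, List.getElem?_eq_getElem h]
  · by_contra hc
    exact hk (lt_three_of_crosses hl h (by simpa using hc))

theorem side_eq_of_code_eq {b b' : ℕ → Bool} {l l' : List ℕ} (h : code b l = code b' l') {i : ℕ}
    (hi : i < l.length) (hi' : i < l'.length) : b (l[i] / 2) = b' (l'[i] / 2) := by
  have h1 := getElem_code b l i hi
  have h2 := getElem_code b' l' i hi'
  simp only [h] at h1
  rw [h1] at h2
  exact congrArg Prod.fst h2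

/-- The codes of the `n`-element sets of pins. -/
def codes (b : ℕ → Bool) (n : ℕ) : Set (List CodeLetter) :=
  {w | ∃ l, Descending l ∧ l.length = n ∧ code b l = w}

theorem codes_finite (b : ℕ → Bool) (n : ℕ) : (codes b n).Finite := by
  refine (List.finite_length_eq CodeLetter n).subset ?_
  rintro _ ⟨l, -, rfl, rfl⟩
  simp

/-! ### Gridded permutations and codes -/

/-- The pins `g 0, g 1, …`, listed from the bottom up, form the gridded permutation `s`. -/
structure Realizes (b : ℕ → Bool) {n : ℕ} (s : GriddedPerm n) (g : Fin n → ℕ) : Prop where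
  mono : StrictMono (pinY ∘ g)
  perm : ∀ i j, s.perm.symm i < s.perm.symm j ↔ pinAbscissa b (g i) < pinAbscissa b (g j)
  vline : ∀ i, (s.perm.symm i : ℕ) < s.vline ↔ pinAbscissa b (g i) < 0
  hline : s.hline = 0

theorem Realizes.mem_pinClass {b : ℕ → Bool} {n : ℕ} {s : GriddedPerm n} {g : Fin n → ℕ}
    (h : Realizes b s g) : s ∈ pinClass (phi b) n := by
  refine ⟨g ∘ s.perm, fun i j hij => ?_, fun i j => ?_, fun i => ?_, fun i => ?_⟩
  · simpa [phi_point] using (h.perm (s.perm i) (s.perm j)).1 (by simpa using hij)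
  · simpa [phi_point] using (h.mono.lt_iff_lt (a := s.perm i) (b := s.perm j)).symm
  · simpa [phi_point] using h.vline (s.perm i)
  · simp [phi_point, h.hline]

theorem exists_realizes_of_mem {b : ℕ → Bool} {n : ℕ} {s : GriddedPerm n}
    (hs : s ∈ pinClass (phi b) n) : ∃ g, Realizes b s g := by
  obtain ⟨f, h1, h2, h3, h4⟩ := hs
  simp only [phi_point] at h1 h2 h3 h4
  refine ⟨f ∘ s.perm.symm, fun i j hij => ?_, fun i j => ⟨fun h => h1 _ _ h, fun h => ?_⟩,
    fun i => h3 _, ?_⟩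
  · have := (h2 (s.perm.symm i) (s.perm.symm j)).1 (by simpa using hij)
    simpa using this
  · by_contra hlt
    rcases (not_lt.1 hlt).lt_or_eq with h' | h'
    · exact lt_asymm h (h1 _ _ h')
    · simp [h'] at h
  -- Were the horizontal line above some point, the lowest point would lie below the axis, where
  -- there are no pins.
  · by_contra hne
    have hpos : 0 < (s.hline : ℕ) := Nat.pos_of_ne_zero fun h0 => hne (Fin.ext h0)
    have hn : 0 < n := by
      have := s.hline.isLt
      omega
    have := (h4 (s.perm.symm ⟨0, hn⟩)).1 (by simpa using hpos)
    omega

theorem eq_of_pinAbscissa_eq {b : ℕ → Bool} {p q : ℕ}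
    (h : pinAbscissa b p = pinAbscissa b q) : p = q := by
  apply pinX_injective
  have hp : 0 < pinX p := by unfold pinX; split_ifs <;> omega
  have hq : 0 < pinX q := by unfold pinX; split_ifs <;> omega
  unfold pinAbscissa at h
  split_ifs at h <;> omega

theorem pinAbscissa_neg_iff (b : ℕ → Bool) (p : ℕ) : pinAbscissa b p < 0 ↔ b (p / 2) = false := by
  have hp : 0 < pinX p := by unfold pinX; split_ifs <;> omega
  unfold pinAbscissa
  cases b (p / 2)
  · simp [hp]
  · simp

/-- The horizontal order of two pins `p` above `q` in terms of quadrants and crossings. -/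
theorem pinAbscissa_lt_iff {b : ℕ → Bool} {p q : ℕ} (hpq : p ≠ q) :
    pinAbscissa b p < pinAbscissa b q ↔
      if b (p / 2) then b (q / 2) = true ∧ crosses b p q = true
      else b (q / 2) = true ∨ crosses b p q = false := by
  have hp : 0 < pinX p := by unfold pinX; split_ifs <;> omega
  have hq : 0 < pinX q := by unfold pinX; split_ifs <;> omega
  have hne : pinX p ≠ pinX q := fun h => hpq (pinX_injective h)
  unfold pinAbscissa crosses
  cases b (p / 2) <;> cases b (q / 2) <;> simp <;> omega

/-- Every set of pins, listed from the bottom up, forms a gridded permutation. -/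
theorem exists_realizes (b : ℕ → Bool) {n : ℕ} {g : Fin n → ℕ} (hg : StrictMono (pinY ∘ g)) :
    ∃ s : GriddedPerm n, Realizes b s g := by
  have hinj : Function.Injective g := fun i j h => hg.injective (by simp [h])
  let x : Fin n → ℤ := fun i => pinAbscissa b (g i)
  have hx : Function.Injective x := fun i j h => hinj (eq_of_pinAbscissa_eq h)
  -- Indices of `g` are height ranks, so sorting them by abscissa gives the permutation read from
  -- left to right.
  let σ := Tuple.sort x
  have hσ : StrictMono (x ∘ σ) :=
    (Tuple.monotone_sort x).strictMono_of_injective (hx.comp σ.injective)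
  let c := (Finset.univ.filter fun i => (x ∘ σ) i < 0).card
  have hc : c < n + 1 := Nat.lt_succ_of_le ((Finset.card_le_univ _).trans (by simp))
  refine ⟨⟨σ, ⟨c, hc⟩, 0⟩, hg, fun i j => ?_, fun i => ?_, rfl⟩
  · have := hσ.lt_iff_lt (a := σ.symm i) (b := σ.symm j)
    simpa [x] using this.symm
  · have := Tuple.lt_card_lt_iff_apply_lt_of_monotone (f := x ∘ σ) (a := 0) hσ.monotone
      (j := σ.symm i)
    simpa [x, c] using this

/-- The pins of `g`, listed from the top down. -/
def topDown {n : ℕ} (g : Fin n → ℕ) : List ℕ := List.ofFn (g ∘ Fin.rev)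

@[simp] theorem length_topDown {n : ℕ} (g : Fin n → ℕ) : (topDown g).length = n := by
  simp [topDown]

theorem descending_topDown {n : ℕ} {g : Fin n → ℕ} (hg : StrictMono (pinY ∘ g)) :
    Descending (topDown g) := by
  unfold Descending topDown
  rw [List.pairwise_ofFn]
  intro i j hij
  exact hg (Fin.rev_lt_rev.2 hij)

theorem exists_topDown {l : List ℕ} (hl : Descending l) :
    ∃ g : Fin l.length → ℕ, StrictMono (pinY ∘ g) ∧ topDown g = l := by
  refine ⟨fun i => l.get i.rev, fun i j hij => ?_, ?_⟩
  · exact List.pairwise_iff_get.1 hl _ _ (Fin.rev_lt_rev.2 hij)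
  · unfold topDown
    conv_rhs => rw [← List.ofFn_get l]
    congr 1
    funext i
    exact congrArg l.get (Fin.rev_rev i)

theorem getElem_topDown {n : ℕ} (g : Fin n → ℕ) (i : Fin n) :
    (topDown g)[(i.rev : ℕ)]'(by rw [length_topDown]; exact i.rev.isLt) = g i := by
  simp only [topDown, List.getElem_ofFn, Function.comp]
  congr 1
  ext
  simp
  omega

theorem side_eq_of_topDown {b : ℕ → Bool} {n : ℕ} {g g' : Fin n → ℕ}
    (h : code b (topDown g) = code b (topDown g')) (i : Fin n) :
    b (g i / 2) = b (g' i / 2) := by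
  have := side_eq_of_code_eq h (i := i.rev) (by rw [length_topDown]; exact i.rev.isLt)
    (by rw [length_topDown]; exact i.rev.isLt)
  simpa only [getElem_topDown] using this

theorem crosses_eq_of_topDown {b : ℕ → Bool} {n : ℕ} {g g' : Fin n → ℕ}
    (hg : StrictMono (pinY ∘ g)) (hg' : StrictMono (pinY ∘ g'))
    (h : code b (topDown g) = code b (topDown g')) {i j : Fin n} (hij : j < i) :
    crosses b (g i) (g j) = crosses b (g' i) (g' j) := by
  have hk : (j.rev : ℕ) = i.rev + 1 + (j.rev - i.rev - 1) := by
    have : (i.rev : ℕ) < j.rev := Fin.rev_lt_rev.2 hij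
    omega
  have hlt : (i.rev : ℕ) + 1 + (j.rev - i.rev - 1) < n := by rw [← hk]; omega
  have h1 := crosses_eq_codeCrosses (b := b) (descending_topDown hg) (i := i.rev)
    (k := j.rev - i.rev - 1) (by simpa using hlt)
  have h2 := crosses_eq_codeCrosses (b := b) (descending_topDown hg') (i := i.rev)
    (k := j.rev - i.rev - 1) (by simpa using hlt)
  rw [h, ← h2] at h1
  simp only [← hk, getElem_topDown] at h1
  exact h1

/-- Two sets of pins with the same code form the same gridded permutation. -/
theorem Realizes.eq_of_code_eq {b : ℕ → Bool} {n : ℕ} {s s' : GriddedPerm n} {g g' : Fin n → ℕ}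
    (hs : Realizes b s g) (hs' : Realizes b s' g')
    (h : code b (topDown g) = code b (topDown g')) : s = s' := by
  have hlt : ∀ i j, j < i → (s.perm.symm i < s.perm.symm j ↔ s'.perm.symm i < s'.perm.symm j) := by
    intro i j hij
    have hne : g i ≠ g j := fun e => (hs.mono hij).ne (by simp [e])
    have hne' : g' i ≠ g' j := fun e => (hs'.mono hij).ne (by simp [e])
    rw [hs.perm, hs'.perm, pinAbscissa_lt_iff hne, pinAbscissa_lt_iff hne',
      side_eq_of_topDown h, side_eq_of_topDown h, crosses_eq_of_topDown hs.mono hs'.mono h hij]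
  have hall : ∀ i j, s.perm.symm i < s.perm.symm j ↔ s'.perm.symm i < s'.perm.symm j := by
    intro i j
    rcases lt_trichotomy i j with hij | rfl | hij
    · have e : ∀ t : GriddedPerm n, t.perm.symm i < t.perm.symm j ↔
          ¬ t.perm.symm j < t.perm.symm i := by
        intro t
        rw [not_lt, le_iff_lt_or_eq]
        simp [hij.ne]
      rw [e, e, hlt _ _ hij]
    · simp
    · exact hlt _ _ hij
  have hperm : s.perm = s'.perm := by
    -- The identity is the only order-preserving permutation of `Fin n`.
    have hm : StrictMono (s.perm.trans s'.perm.symm) := by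
      intro i j hij
      simpa using (hall (s.perm i) (s.perm j)).1 (by simpa using hij)
    have hmono := Finset.orderEmbOfFin_unique (s := (Finset.univ : Finset (Fin n))) (k := n)
      (by simp) (fun _ => Finset.mem_univ _) hm
    have hid := Finset.orderEmbOfFin_unique (s := (Finset.univ : Finset (Fin n))) (k := n)
      (by simp) (fun _ => Finset.mem_univ _) (strictMono_id (α := Fin n))
    ext i
    have : s'.perm.symm (s.perm i) = i := congrFun (hmono.trans hid.symm) i
    rw [Equiv.symm_apply_eq] at this
    rw [this]
  refine GriddedPerm.ext hperm ?_ (hs.hline.trans hs'.hline.symm)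
  have hv : ∀ i : Fin n, (i : ℕ) < s.vline ↔ (i : ℕ) < s'.vline := by
    intro i
    have h1 := hs.vline (s.perm i)
    have h2 := hs'.vline (s.perm i)
    rw [pinAbscissa_neg_iff, side_eq_of_topDown h, ← pinAbscissa_neg_iff, ← h2] at h1
    simpa [← hperm] using h1
  have h1 := s.vline.isLt
  have h2 := s'.vline.isLt
  ext
  by_contra hne
  rcases Nat.lt_or_gt_of_ne hne with hc | hc
  · have := hv ⟨s.vline, by omega⟩
    simp at this
    omega
  · have := hv ⟨s'.vline, by omega⟩
    simp at this
    omega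

/-- Two sets of pins that form the same gridded permutation have the same code. -/
theorem Realizes.code_eq {b : ℕ → Bool} {n : ℕ} {s : GriddedPerm n} {g g' : Fin n → ℕ}
    (hs : Realizes b s g) (hs' : Realizes b s g') : code b (topDown g) = code b (topDown g') := by
  have hside : ∀ i, b (g i / 2) = b (g' i / 2) := by
    intro i
    have h1 := hs.vline i
    rw [hs'.vline i, pinAbscissa_neg_iff, pinAbscissa_neg_iff] at h1
    cases h : b (g i / 2) <;> cases h' : b (g' i / 2) <;> simp_all
  have hcross : ∀ i j, j < i → crosses b (g i) (g j) = crosses b (g' i) (g' j) := by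
    intro i j hij
    have hne : g i ≠ g j := fun e => (hs.mono hij).ne (by simp [e])
    have hne' : g' i ≠ g' j := fun e => (hs'.mono hij).ne (by simp [e])
    have h1 := hs.perm i j
    rw [hs'.perm i j, pinAbscissa_lt_iff hne, pinAbscissa_lt_iff hne', hside i, hside j] at h1
    have hij' := hside i
    have hj' := hside j
    -- On a common side the horizontal order reveals the crossing; on different sides there is none
    -- by definition.
    by_cases he : b (g' i / 2) = b (g' j / 2)
    · cases h : b (g' i / 2) <;> cases h' : crosses b (g i) (g j) <;>
        cases h'' : crosses b (g' i) (g' j) <;> simp_all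
    · simp only [crosses, hside, beq_eq_false_iff_ne.2 he, Bool.false_and]
  apply List.ext_getElem (by simp)
  intro k h1 h2
  rw [length_code, length_topDown] at h1
  rw [getElem_code _ _ _ (by simpa using h1), getElem_code _ _ _ (by simpa using h1)]
  have hget : ∀ (f : Fin n → ℕ) (m : ℕ) (hm : m < n),
      (topDown f)[m]'(by simpa using hm) = f (Fin.rev ⟨m, hm⟩) := by
    intro f m hm
    simp [topDown]
  ext i
  · simp only [pinCode, hget _ _ h1, hside]
  · simp only [pinCode, List.getElem?_drop]
    by_cases hm : k + 1 + i < n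
    · rw [List.getElem?_eq_getElem (by simpa using hm),
        List.getElem?_eq_getElem (by simpa using hm), hget _ _ h1, hget _ _ h1, hget _ _ hm,
        hget _ _ hm, Option.any_some, Option.any_some, hcross]
      rw [Fin.rev_lt_rev, Fin.lt_def]
      simp
      omega
    · rw [List.getElem?_eq_none (by simpa using hm), List.getElem?_eq_none (by simpa using hm)]
      rfl

/-- The pin class `C_{φ(b)}` is counted by the codes of the sets of pins. -/
theorem ncard_pinClass (b : ℕ → Bool) (n : ℕ) :
    (pinClass (phi b) n).ncard = (codes b n).ncard := by
  have hex : ∀ s (hs : s ∈ pinClass (phi b) n), ∃ g, Realizes b s g := fun s hs =>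
    exists_realizes_of_mem hs
  choose! G hG using hex
  refine Set.ncard_congr (fun s _ => code b (topDown (G s))) ?_ ?_ ?_
  · intro s hs
    exact ⟨_, descending_topDown (hG s hs).mono, by simp, rfl⟩
  · intro s s' hs hs' h
    exact (hG s hs).eq_of_code_eq (hG s' hs') h
  · rintro _ ⟨l, hl, rfl, rfl⟩
    obtain ⟨g, hg, hgl⟩ := exists_topDown hl
    obtain ⟨s, hs⟩ := exists_realizes b hg
    refine ⟨s, hs.mem_pinClass, ?_⟩
    rw [(hG s hs.mem_pinClass).code_eq hs, hgl]

/-! ### Existence of the growth rate -/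

open Filter Topology

/-- Fekete's lemma applied to `log (K * s n)`; the constant disappears after division by `n`. -/
theorem exists_hasGrowthRate {s : ℕ → ℕ} {K : ℕ} (hs : ∀ n, 0 < s n) (hK : 0 < K)
    (hsub : ∀ m n, s (m + n) ≤ K * (s m * s n)) : ∃ g, HasGrowthRate s g := by
  let u : ℕ → ℝ := fun n => Real.log (K * s n)
  have hK' : (0 : ℝ) < K := by exact_mod_cast hK
  have hs' : ∀ n, (0 : ℝ) < s n := fun n => by exact_mod_cast hs n
  have hu : Subadditive u := by
    intro m n
    have h1 : (s (m + n) : ℝ) ≤ K * (s m * s n) := by exact_mod_cast hsub m n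
    have hm := hs' m
    have hn := hs' n
    have hmn := hs' (m + n)
    show Real.log _ ≤ Real.log _ + Real.log _
    rw [← Real.log_mul (by positivity) (by positivity)]
    apply Real.log_le_log (by positivity)
    nlinarith
  have hbdd : BddBelow (Set.range fun n => u n / n) := by
    refine ⟨0, ?_⟩
    rintro _ ⟨n, rfl⟩
    refine div_nonneg (Real.log_nonneg ?_) (Nat.cast_nonneg n)
    exact_mod_cast Nat.mul_pos hK (hs n)
  have hlim := hu.tendsto_lim hbdd
  have hc : Tendsto (fun n : ℕ => Real.log K / (n : ℝ)) atTop (𝓝 0) :=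
    tendsto_const_div_atTop_nhds_zero_nat _
  refine ⟨Real.exp hu.lim, ?_⟩
  have h := (Real.continuous_exp.tendsto _).comp (hlim.sub hc)
  rw [sub_zero] at h
  refine h.congr fun n => ?_
  have hlog : u n = Real.log K + Real.log (s n) := Real.log_mul hK'.ne' (hs' n).ne'
  rw [Real.rpow_def_of_pos (hs' n), Function.comp, hlog]
  congr 1
  ring

theorem HasGrowthRate.le_of_pow_le {s : ℕ → ℕ} {g c r : ℝ} (h : HasGrowthRate s g) (hc : 0 < c)
    (hr : 0 < r) (hle : ∀ n, c * r ^ n ≤ s n) : r ≤ g := by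
  have h0 : Tendsto (fun n : ℕ => (1 : ℝ) / (n : ℝ)) atTop (𝓝 0) :=
    tendsto_const_div_atTop_nhds_zero_nat _
  have h1 : Tendsto (fun n : ℕ => c ^ (1 / (n : ℝ)) * r) atTop (𝓝 r) := by
    have := ((Real.continuousAt_const_rpow (b := 0) hc.ne').tendsto.comp h0).mul_const r
    simpa [Function.comp_def] using this
  refine le_of_tendsto_of_tendsto h1 h ?_
  filter_upwards [eventually_gt_atTop 0] with n hn
  have hn' : (n : ℝ) ≠ 0 := by exact_mod_cast hn.ne'
  calc c ^ (1 / (n : ℝ)) * r = (c * r ^ n) ^ (1 / (n : ℝ)) := by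
        rw [Real.mul_rpow hc.le (by positivity), ← Real.rpow_natCast, ← Real.rpow_mul hr.le,
          mul_one_div_cancel hn', Real.rpow_one]
    _ ≤ _ := Real.rpow_le_rpow (by positivity) (hle n) (by positivity)

theorem codes_pos (b : ℕ → Bool) (n : ℕ) : 0 < (codes b n).ncard := by
  rw [Set.ncard_pos (codes_finite b n)]
  -- Even pins alone are ordered by height exactly as by index.
  have h : ∃ l, Descending l ∧ l.length = n ∧ ∀ p ∈ l, p < 2 * n ∧ p % 2 = 0 := by
    induction n with
    | zero => exact ⟨[], List.Pairwise.nil, rfl, by simp⟩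
    | succ n ih =>
      obtain ⟨l, hl, hn, hp⟩ := ih
      refine ⟨2 * n :: l, List.pairwise_cons.2 ⟨fun q hq => ?_, hl⟩, by simp [hn], ?_⟩
      · rw [pinY_lt_iff]
        have := hp q hq
        omega
      · intro p hp'
        rcases List.mem_cons.1 hp' with rfl | hp'
        · omega
        · have := hp p hp'
          omega
  obtain ⟨l, hl, hn, -⟩ := h
  exact ⟨_, l, hl, hn, rfl⟩

theorem drop_code_append (b : ℕ → Bool) (l₁ l₂ : List ℕ) :
    (code b (l₁ ++ l₂)).drop l₁.length = code b l₂ := by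
  induction l₁ with
  | nil => simp
  | cons p l ih => simpa using ih

theorem pinCode_append {b : ℕ → Bool} {p : ℕ} {l₁ : List ℕ} (l₂ : List ℕ) (h : 3 ≤ l₁.length) :
    pinCode b p (l₁ ++ l₂) = pinCode b p l₁ := by
  refine Prod.ext rfl (funext fun i => ?_)
  have hi : (i : ℕ) < l₁.length := by omega
  simp [pinCode, List.getElem?_append_left hi]

theorem take_code_append (b : ℕ → Bool) (l₁ l₂ : List ℕ) (k : ℕ) (h : k + 3 ≤ l₁.length) :
    (code b (l₁ ++ l₂)).take k = (code b l₁).take k := by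
  induction l₁ generalizing k with
  | nil => simp at h
  | cons p l ih =>
    cases k with
    | zero => simp
    | succ k =>
      simp only [List.length_cons] at h
      simp [pinCode_append l₂ (show 3 ≤ l.length by omega), ih k (by omega)]

theorem descending_append {l₁ l₂ : List ℕ} : Descending (l₁ ++ l₂) ↔
    Descending l₁ ∧ Descending l₂ ∧ ∀ p ∈ l₁, ∀ q ∈ l₂, pinY q < pinY p :=
  List.pairwise_append

/-- Cutting after `m` pins leaves the lower code intact and can alter only the last three letters of
the upper one. Recording those letters restores the whole code, so the number of words of length at
most three serves as the constant. -/
theorem exists_codes_submultiplicative (b : ℕ → Bool) :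
    ∃ K, 0 < K ∧ ∀ m n, (codes b (m + n)).ncard ≤ K * ((codes b m).ncard * (codes b n).ncard) := by
  have hF : {w : List CodeLetter | w.length ≤ 3}.Finite := List.finite_length_le _ _
  refine ⟨{w : List CodeLetter | w.length ≤ 3}.ncard, ?_, fun m n => ?_⟩
  · rw [Set.ncard_pos hF]
    exact ⟨[], by simp⟩
  have hex : ∀ w ∈ codes b (m + n), ∃ u ∈ codes b m, w.take (m - 3) = u.take (m - 3) ∧
      w.drop m ∈ codes b n := by
    rintro _ ⟨l, hl, hlen, rfl⟩
    have hm : (l.take m).length = m := by simp [hlen]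
    have hd : Descending (l.take m ++ l.drop m) := by rwa [List.take_append_drop]
    obtain ⟨h1, h2, -⟩ := descending_append.1 hd
    refine ⟨_, ⟨_, h1, hm, rfl⟩, ?_, _, h2, by simp [hlen], ?_⟩
    · by_cases h3 : 3 ≤ m
      · conv_lhs => rw [← List.take_append_drop m l]
        exact take_code_append b _ _ _ (by rw [hm]; omega)
      · simp [show m - 3 = 0 by omega]
    · conv_rhs => rw [← List.take_append_drop m l]
      have := drop_code_append b (l.take m) (l.drop m)
      rw [hm] at this
      exact this.symm
  choose! U hU1 hU2 hU3 using hex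
  rw [← Set.ncard_prod, ← Set.ncard_prod]
  refine Set.ncard_le_ncard_of_injOn
    (fun w => ((w.take m).drop (m - 3), (U w, w.drop m))) ?_ ?_
    (hF.prod ((codes_finite b m).prod (codes_finite b n)))
  · intro w hw
    refine ⟨?_, hU1 w hw, hU3 w hw⟩
    simp only [Set.mem_ofPred_eq, List.length_drop, List.length_take]
    omega
  · intro w hw w' hw' h
    simp only [Prod.mk.injEq] at h
    obtain ⟨h1, h2, h3⟩ := h
    have h4 : w.take (m - 3) = w'.take (m - 3) := by rw [hU2 w hw, hU2 w' hw', h2]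
    have h5 : w.take m = w'.take m := by
      rw [← List.take_append_drop (m - 3) (w.take m), ← List.take_append_drop (m - 3) (w'.take m),
        h1, List.take_take, List.take_take, Nat.min_eq_left (Nat.sub_le m 3), h4]
    rw [← List.take_append_drop m w, ← List.take_append_drop m w', h5, h3]

theorem exists_hasGrowthRate_pinClass (b : ℕ → Bool) :
    ∃ g, HasGrowthRate (fun n => (pinClass (phi b) n).ncard) g := by
  obtain ⟨K, hK, h⟩ := exists_codes_submultiplicative b
  simp only [ncard_pinClass]
  exact exists_hasGrowthRate (codes_pos b) hK h

/-! ### Codes that recur, and their indecomposable blocks -/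

/-- The codes of length `n` of sets of pins that lie arbitrarily far out. -/
def recurrentCodes (b : ℕ → Bool) (n : ℕ) : Set (List CodeLetter) :=
  {w | w.length = n ∧ ∀ P, ∃ l, Descending l ∧ (∀ p ∈ l, P ≤ p) ∧ code b l = w}

theorem recurrentCodes_subset (b : ℕ → Bool) (n : ℕ) : recurrentCodes b n ⊆ codes b n := by
  rintro w ⟨rfl, hw⟩
  obtain ⟨l, hl, -, rfl⟩ := hw 0
  exact ⟨l, hl, by simp, rfl⟩

theorem recurrentCodes_finite (b : ℕ → Bool) (n : ℕ) : (recurrentCodes b n).Finite :=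
  (codes_finite b n).subset (recurrentCodes_subset b n)

/-- No pin in the code crosses a pin beyond the end of the code. -/
def IsClosedCode (w : List CodeLetter) : Prop :=
  ∀ i k, codeCrosses w i k = true → i + 1 + k < w.length

/-- A nonempty code of which no proper nonempty prefix is closed. -/
def IsIndecomposable (w : List CodeLetter) : Prop :=
  w ≠ [] ∧ ∀ v, v <+: w → v ≠ [] → IsClosedCode v → v = w

/-- Missing places count as not crossed in `pinCode`. -/
theorem isClosedCode_code (b : ℕ → Bool) (l : List ℕ) : IsClosedCode (code b l) := by
  intro i k h
  unfold codeCrosses at h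
  split_ifs at h with hk
  by_contra! hlt
  rw [length_code] at hlt
  by_cases hi : i < l.length
  · rw [List.getElem?_eq_getElem (by simpa using hi), getElem_code b l i hi] at h
    simp [pinCode, List.getElem?_eq_none hlt] at h
  · rw [List.getElem?_eq_none (by simpa using hi)] at h
    simp at h

theorem isClosedCode_of_mem {b : ℕ → Bool} {n : ℕ} {w : List CodeLetter}
    (hw : w ∈ recurrentCodes b n) : IsClosedCode w := by
  obtain ⟨l, -, -, rfl⟩ := hw.2 0
  exact isClosedCode_code b l

/-- The code of `l` is indecomposable if there is a crossing at each place where `l` can be cut. -/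
theorem isIndecomposable_code {b : ℕ → Bool} {l : List ℕ} (hl : Descending l) (hne : l ≠ [])
    (h : ∀ l₁ l₂, l = l₁ ++ l₂ → l₁ ≠ [] → l₂ ≠ [] →
      ∃ p ∈ l₁, ∃ q ∈ l₂, crosses b p q = true) : IsIndecomposable (code b l) := by
  refine ⟨fun h0 => hne (List.eq_nil_of_length_eq_zero (by simpa using congrArg List.length h0)),
    fun v hv hv0 hcl => ?_⟩
  have hvlen : v.length ≤ l.length := by simpa using hv.length_le
  have hv0' : 0 < v.length := List.length_pos_iff.2 hv0
  by_contra hvl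
  have hlt : v.length < l.length := lt_of_le_of_ne hvlen fun e =>
    hvl (hv.eq_of_length (by simpa using e))
  obtain ⟨p, hp, q, hq, hc⟩ := h (l.take v.length) (l.drop v.length)
    (List.take_append_drop _ _).symm
    (List.ne_nil_of_length_pos (by simp; omega)) (List.ne_nil_of_length_pos (by simp; omega))
  obtain ⟨i, hi, rfl⟩ := List.getElem_of_mem hp
  obtain ⟨j, hj, rfl⟩ := List.getElem_of_mem hq
  simp only [List.length_take, List.length_drop] at hi hj
  simp only [List.getElem_take, List.getElem_drop] at hc
  have hij : v.length + j = i + 1 + (v.length + j - i - 1) := by omega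
  have hcc := crosses_eq_codeCrosses (b := b) hl (i := i) (k := v.length + j - i - 1)
    (by omega)
  simp only [← hij, hc] at hcc
  -- The prefix carries the same letter at `i`, so it records a crossing that reaches past its own
  -- end.
  have hvi : (code b l)[i]? = v[i]? := by
    obtain ⟨t, ht⟩ := hv
    rw [← ht, List.getElem?_append_left (by omega)]
  have hclv := hcl i (v.length + j - i - 1) (by
    rw [hcc]
    simp only [codeCrosses, hvi])
  omega

theorem code_append {b : ℕ → Bool} {l₁ l₂ : List ℕ}
    (h : ∀ p ∈ l₁, ∀ q ∈ l₂, crosses b p q = false) :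
    code b (l₁ ++ l₂) = code b l₁ ++ code b l₂ := by
  induction l₁ with
  | nil => rfl
  | cons p l ih =>
    rw [List.cons_append, code_cons, code_cons, List.cons_append,
      ih fun q hq => h q (List.mem_cons_of_mem _ hq)]
    congr 1
    refine Prod.ext rfl (funext fun i => ?_)
    simp only [pinCode]
    by_cases hi : (i : ℕ) < l.length
    · rw [List.getElem?_append_left hi]
    · rw [List.getElem?_append_right (by omega), List.getElem?_eq_none (l := l) (by omega)]
      cases hg : l₂[(i : ℕ) - l.length]? with
      | none => rfl
      | some q => simpa using h p (by simp) q (List.mem_of_getElem? hg)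

theorem exists_bound (l : List ℕ) : ∃ M, ∀ p ∈ l, p < M := by
  induction l with
  | nil => exact ⟨0, by simp⟩
  | cons p l ih =>
    obtain ⟨M, hM⟩ := ih
    refine ⟨max M (p + 1), fun q hq => ?_⟩
    rcases List.mem_cons.1 hq with rfl | hq
    · exact lt_max_of_lt_right (Nat.lt_succ_self _)
    · exact lt_max_of_lt_left (hM q hq)

theorem append_mem_recurrentCodes {b : ℕ → Bool} {m n : ℕ} {v w : List CodeLetter}
    (hv : v ∈ recurrentCodes b m) (hw : w ∈ recurrentCodes b n) :
    v ++ w ∈ recurrentCodes b (m + n) := by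
  refine ⟨by simp [hv.1, hw.1], fun P => ?_⟩
  obtain ⟨l₂, hl₂, hP₂, rfl⟩ := hw.2 P
  obtain ⟨M, hM⟩ := exists_bound l₂
  -- The upper set is realised so far out that no pin of it is a neighbour of a pin of `l₂`; no
  -- crossings arise between the two sets.
  obtain ⟨l₁, hl₁, hP₁, rfl⟩ := hv.2 (P + M + 1)
  have hlt : ∀ p ∈ l₁, ∀ q ∈ l₂, pinY q < pinY p := by
    intro p hp q hq
    rw [pinY_lt_iff]
    have := hM q hq
    have := hP₁ p hp
    omega
  refine ⟨l₁ ++ l₂, descending_append.2 ⟨hl₁, hl₂, hlt⟩, ?_, code_append fun p hp q hq => ?_⟩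
  · intro p hp
    rcases List.mem_append.1 hp with hp | hp
    · have := hP₁ p hp
      omega
    · exact hP₂ p hp
  · by_contra hc
    obtain ⟨-, -, h⟩ := (crosses_iff (hlt p hp q hq)).1 (by simpa using hc)
    have := hM q hq
    have := hP₁ p hp
    omega

/-- The indecomposable codes of length `n` that recur. -/
def recurrentBlocks (b : ℕ → Bool) (n : ℕ) : Set (List CodeLetter) :=
  {w ∈ recurrentCodes b n | IsIndecomposable w}

theorem recurrentBlocks_finite (b : ℕ → Bool) (n : ℕ) : (recurrentBlocks b n).Finite :=
  (recurrentCodes_finite b n).subset fun _ h => h.1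

/-- Two prefixes of one word are comparable, and the shorter is a closed nonempty prefix of the
other, which is indecomposable. -/
theorem eq_of_append_eq_append {v v' w w' : List CodeLetter} (hv : IsIndecomposable v)
    (hv' : IsIndecomposable v') (hc : IsClosedCode v) (hc' : IsClosedCode v')
    (h : v ++ w = v' ++ w') : v = v' ∧ w = w' := by
  have hvv : v = v' := by
    rcases List.prefix_or_prefix_of_prefix (List.prefix_append v w)
      (h ▸ List.prefix_append v' w') with hp | hp
    · exact hv'.2 v hp hv.1 hc
    · exact (hv.2 v' hp hv'.1 hc').symm
  subst hvv
  exact ⟨rfl, List.append_cancel_left h⟩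

/-- Prepending a block to a recurrent code gives a recurrent code from which both parts can be
recovered, so different block lengths contribute disjoint sets. -/
theorem sum_le_ncard_recurrentCodes (b : ℕ → Bool) (n : ℕ) :
    ∑ i ∈ Finset.range n, (recurrentBlocks b (i + 1)).ncard * (recurrentCodes b (n - (i + 1))).ncard
      ≤ (recurrentCodes b n).ncard := by
  classical
  let S : ℕ → Set (List CodeLetter) := fun i =>
    (fun x : List CodeLetter × List CodeLetter => x.1 ++ x.2) ''
      (recurrentBlocks b (i + 1) ×ˢ recurrentCodes b (n - (i + 1)))
  have hSfin : ∀ i, (S i).Finite := fun i =>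
    ((recurrentBlocks_finite b _).prod (recurrentCodes_finite b _)).image _
  have hScard : ∀ i, (S i).ncard =
      (recurrentBlocks b (i + 1)).ncard * (recurrentCodes b (n - (i + 1))).ncard := by
    intro i
    rw [← Set.ncard_prod]
    refine Set.InjOn.ncard_image ?_
    rintro ⟨v, w⟩ ⟨hv, hw⟩ ⟨v', w'⟩ ⟨hv', hw'⟩ h
    obtain ⟨h1, h2⟩ := eq_of_append_eq_append hv.2 hv'.2 (isClosedCode_of_mem hv.1)
      (isClosedCode_of_mem hv'.1) h
    exact Prod.ext h1 h2
  have hdisj : ∀ i j, i ≠ j → Disjoint (S i) (S j) := by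
    intro i j hij
    rw [Set.disjoint_left]
    rintro _ ⟨⟨v, w⟩, ⟨hv, hw⟩, rfl⟩ ⟨⟨v', w'⟩, ⟨hv', hw'⟩, h⟩
    have := (eq_of_append_eq_append hv'.2 hv.2 (isClosedCode_of_mem hv'.1)
      (isClosedCode_of_mem hv.1) h).1
    have h1 := hv.1.1
    have h2 := hv'.1.1
    simp only at this h1 h2
    rw [this, h1] at h2
    omega
  have hsub : ∀ i ∈ Finset.range n, S i ⊆ recurrentCodes b n := by
    rintro i hi _ ⟨⟨v, w⟩, ⟨hv, hw⟩, rfl⟩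
    have := append_mem_recurrentCodes hv.1 hw
    rwa [Nat.add_sub_cancel' (Finset.mem_range.1 hi)] at this
  calc ∑ i ∈ Finset.range n, (recurrentBlocks b (i + 1)).ncard *
        (recurrentCodes b (n - (i + 1))).ncard
      = ∑ i ∈ Finset.range n, (hSfin i).toFinset.card := by
        refine Finset.sum_congr rfl fun i _ => ?_
        rw [← hScard, Set.ncard_eq_toFinset_card _ (hSfin i)]
    _ = ((Finset.range n).biUnion fun i => (hSfin i).toFinset).card := by
        rw [Finset.card_biUnion]
        intro i _ j _ hij
        exact Set.Finite.disjoint_toFinset.2 (hdisj i j hij)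
    _ ≤ (recurrentCodes_finite b n).toFinset.card := by
        refine Finset.card_le_card fun w hw => ?_
        obtain ⟨i, hi, hw⟩ := Finset.mem_biUnion.1 hw
        rw [Set.Finite.mem_toFinset] at hw ⊢
        exact hsub i hi hw
    _ = _ := (Set.ncard_eq_toFinset_card _ _).symm

theorem recurrentCodes_zero_pos (b : ℕ → Bool) : 0 < (recurrentCodes b 0).ncard := by
  rw [Set.ncard_pos (recurrentCodes_finite b 0)]
  exact ⟨[], rfl, fun P => ⟨[], List.Pairwise.nil, by simp, rfl⟩⟩

/-! ### Blocks from contiguous factors -/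

/-- The pins `j, …, j + n - 1`, listed from the top down. -/
def intervalList (j : ℕ) : ℕ → List ℕ
  | 0 => []
  | 1 => [j]
  | n + 2 =>
    if (j + n + 1) % 2 = 1 then (j + n + 1) :: intervalList j (n + 1)
    else (j + n) :: (j + n + 1) :: intervalList j n

theorem mem_intervalList {j n p : ℕ} : p ∈ intervalList j n ↔ j ≤ p ∧ p < j + n := by
  fun_induction intervalList j n with
  | case1 => simp
  | case2 => simp; omega
  | case3 n h ih => simp only [List.mem_cons, ih]; omega
  | case4 n h ih => simp only [List.mem_cons, ih]; omega

theorem length_intervalList (j n : ℕ) : (intervalList j n).length = n := by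
  fun_induction intervalList j n with
  | case1 => rfl
  | case2 => rfl
  | case3 n h ih => simp [ih]
  | case4 n h ih => simp [ih]

theorem descending_intervalList (j n : ℕ) : Descending (intervalList j n) := by
  fun_induction intervalList j n with
  | case1 => exact List.Pairwise.nil
  | case2 => exact List.pairwise_singleton _ _
  | case3 n h ih =>
    refine List.pairwise_cons.2 ⟨fun q hq => ?_, ih⟩
    rw [mem_intervalList] at hq
    rw [pinY_lt_iff]
    omega
  | case4 n h ih =>
    refine List.pairwise_cons.2 ⟨fun q hq => ?_, List.pairwise_cons.2 ⟨fun q hq => ?_, ih⟩⟩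
    · rw [List.mem_cons, mem_intervalList] at hq
      rw [pinY_lt_iff]
      omega
    · rw [mem_intervalList] at hq
      rw [pinY_lt_iff]
      omega

theorem intervalList_add (j s n : ℕ) :
    intervalList (j + 2 * s) n = (intervalList j n).map (· + 2 * s) := by
  fun_induction intervalList j n with
  | case1 => rfl
  | case2 => rfl
  | case3 n h ih =>
    rw [intervalList, if_pos (by omega), ih]
    simp only [List.map_cons, List.cons.injEq, and_true]
    omega
  | case4 n h ih =>
    rw [intervalList, if_neg (by omega), ih]
    simp only [List.map_cons, List.cons.injEq, and_true]
    omega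

/-- An odd pin always crosses its even predecessor, since both come from one digit. A cut without
crossings therefore has a lower part closed under successors of the index, so the upper part has the
smaller indices yet lies higher. Only an odd pin and its successor allow this, which is the excluded
case of length two. -/
theorem isIndecomposable_intervalList (b : ℕ → Bool) {j n : ℕ} (hn : 0 < n)
    (h2 : n = 2 → j % 2 = 0) : IsIndecomposable (code b (intervalList j n)) := by
  have hlen := length_intervalList j n
  refine isIndecomposable_code (descending_intervalList j n)
    (List.ne_nil_of_length_pos (by omega)) fun l₁ l₂ hl h₁ h₂ => ?_
  by_contra! hcr
  have hd := descending_intervalList j n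
  rw [hl, descending_append] at hd
  have hY := hd.2.2
  have hmem : ∀ p, (p ∈ l₁ ∨ p ∈ l₂) ↔ j ≤ p ∧ p < j + n := by
    intro p
    rw [← List.mem_append, ← hl, mem_intervalList]
  have hnot : ∀ p ∈ l₁, p ∉ l₂ := fun p hp hp' => lt_irrefl _ (hY p hp p hp')
  have hup : ∀ p ∈ l₂, p + 1 < j + n → p + 1 ∈ l₂ := by
    intro p hp hpn
    have hj := (hmem p).1 (Or.inr hp)
    rcases (hmem (p + 1)).2 (by omega) with hp1 | hp1
    · have hlt := hY _ hp1 _ hp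
      rw [pinY_lt_iff] at hlt
      refine absurd ((crosses_iff (hY _ hp1 _ hp)).2 ⟨?_, by omega, Or.inl rfl⟩) (hcr _ hp1 _ hp)
      congr 1
      omega
    · exact hp1
  obtain ⟨a, ha⟩ := List.exists_mem_of_ne_nil _ h₁
  obtain ⟨c, hc⟩ := List.exists_mem_of_ne_nil _ h₂
  have haI := (hmem a).1 (Or.inl ha)
  have hcI := (hmem c).1 (Or.inr hc)
  have hup' : ∀ k p, p ∈ l₂ → p + k < j + n → p + k ∈ l₂ := by
    intro k
    induction k with
    | zero => exact fun p hp _ => hp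
    | succ k ih => exact fun p hp h => hup _ (ih p hp (by omega)) (by omega)
  have hac : ∀ p ∈ l₁, ∀ q ∈ l₂, p < q := by
    intro p hp q hq
    by_contra! hpq
    have := hup' (p - q) q hq (by have := (hmem p).1 (Or.inl hp); omega)
    rw [Nat.add_sub_cancel' hpq] at this
    exact hnot p hp this
  have hYac : ∀ p ∈ l₁, ∀ q ∈ l₂, p % 2 = 1 ∧ q = p + 1 := by
    intro p hp q hq
    have h1 := hY p hp q hq
    have h2 := hac p hp q hq
    rw [pinY_lt_iff] at h1
    omega
  have hone := hYac a ha c hc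
  have hja : a = j := by
    by_contra hne
    rcases (hmem (a - 1)).2 (by omega) with h | h
    · have := hYac _ h c hc
      omega
    · have := hac a ha _ h
      omega
  have hcn : c = j + n - 1 := by
    by_contra hne
    have h := hup' 1 c hc (by omega)
    have := hYac a ha _ h
    omega
  have := h2 (by omega)
  omega

theorem code_congr {b b' : ℕ → Bool} {l : List ℕ} (h : ∀ p ∈ l, b (p / 2) = b' (p / 2)) :
    code b l = code b' l := by
  induction l with
  | nil => rfl
  | cons p l ih =>
    rw [code_cons, code_cons, ih fun q hq => h q (List.mem_cons_of_mem _ hq)]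
    congr 1
    refine Prod.ext (h p (by simp)) (funext fun i => ?_)
    simp only [pinCode]
    cases hg : l[(i : ℕ)]? with
    | none => rfl
    | some q =>
      simp [crosses, h p (by simp), h q (List.mem_cons_of_mem _ (List.mem_of_getElem? hg))]

theorem crosses_add (b : ℕ → Bool) (s p q : ℕ) :
    crosses b (p + 2 * s) (q + 2 * s) = crosses (fun i => b (i + s)) p q := by
  have hd : ∀ p, (p + 2 * s) / 2 = p / 2 + s := fun p => by omega
  have hX : pinX (p + 2 * s) < pinX (q + 2 * s) ↔ pinX p < pinX q := by
    unfold pinX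
    split_ifs <;> omega
  simp only [crosses, hd, hX]

theorem code_map_add (b : ℕ → Bool) (s : ℕ) (l : List ℕ) :
    code b (l.map (· + 2 * s)) = code (fun i => b (i + s)) l := by
  induction l with
  | nil => rfl
  | cons p l ih =>
    rw [List.map_cons, code_cons, code_cons, ih]
    congr 1
    refine Prod.ext ?_ (funext fun i => ?_)
    · simp only [pinCode]
      congr 1
      omega
    · simp only [pinCode, List.getElem?_map]
      cases l[(i : ℕ)]? with
      | none => rfl
      | some q => simp [crosses_add]

/-- A finite word, continued by zeros. -/
def extendWord {K : ℕ} (u : Fin K → Bool) (i : ℕ) : Bool := if h : i < K then u ⟨i, h⟩ else false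

/-- The code of the factor of length `n` of the pin sequence of the word `u` that starts at its
pin `ε`. -/
def factorCode (ε n : ℕ) (u : Fin ((ε + n + 1) / 2) → Bool) : List CodeLetter :=
  code (extendWord u) (intervalList ε n)

theorem factorCode_mem_recurrentBlocks {b : ℕ → Bool} {ε n : ℕ} (hn : 0 < n)
    (h2 : n = 2 → ε % 2 = 0) {u : Fin ((ε + n + 1) / 2) → Bool}
    (hu : u ∈ recurrentFactors b ((ε + n + 1) / 2)) :
    factorCode ε n u ∈ recurrentBlocks b n := by
  refine ⟨⟨by simp [factorCode, length_intervalList], fun P => ?_⟩,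
    isIndecomposable_intervalList _ hn h2⟩
  obtain ⟨s, hs, hsP⟩ := Set.Infinite.exists_gt hu P
  -- An occurrence of `u` at digit `s` starts at pin `2 * s`; the even shift preserves parities and
  -- hence crossings.
  refine ⟨intervalList (ε + 2 * s) n, descending_intervalList _ _, fun p hp => ?_, ?_⟩
  · rw [mem_intervalList] at hp
    omega
  · rw [intervalList_add, code_map_add]
    refine code_congr fun p hp => ?_
    rw [mem_intervalList] at hp
    have hlt : p / 2 < (ε + n + 1) / 2 := by omega
    have := hs ⟨p / 2, hlt⟩
    simp only [extendWord, dif_pos hlt]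
    rw [← this, Nat.add_comm]

/-- Every digit of the word is the side of some pin in the interval: pin `ε` for digit 0, pin `2 *
k` for a later digit `k`. -/
theorem factorCode_injective {ε n : ℕ} (hε : ε ≤ 1) (hn : 0 < n) :
    Function.Injective (factorCode ε n) := by
  intro u v h
  funext k
  obtain ⟨p, hp, hpk⟩ : ∃ p ∈ intervalList ε n, p / 2 = k := by
    have hk := k.isLt
    by_cases hk0 : (k : ℕ) = 0
    · exact ⟨ε, mem_intervalList.2 (by omega), by omega⟩
    · exact ⟨2 * k, mem_intervalList.2 (by omega), by omega⟩
  obtain ⟨i, hi, rfl⟩ := List.getElem_of_mem hp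
  have := side_eq_of_code_eq h hi hi
  rw [hpk] at this
  simpa [extendWord] using this

/-- The second crossing bit of the first letter of the code of a factor of length at least `4`
tells whether the last pin of the factor has an odd index. -/
theorem codeCrosses_factorCode {ε n : ℕ} (hn : 4 ≤ n) (u : Fin ((ε + n + 1) / 2) → Bool) :
    codeCrosses (factorCode ε n u) 0 1 = decide ((ε + n) % 2 = 0) := by
  obtain ⟨m, rfl⟩ := Nat.exists_eq_add_of_le' hn
  unfold factorCode
  by_cases h : (ε + m) % 2 = 0
  · have hl : intervalList ε (m + 4) = (ε + m + 3) :: (ε + m + 1) :: (ε + m + 2) ::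
        intervalList ε (m + 1) := by
      rw [intervalList, if_pos (by omega), intervalList, if_neg (by omega)]
      rfl
    have hc : crosses (extendWord u) (ε + m + 3) (ε + m + 2) = true := by
      rw [crosses_iff (by rw [pinY_lt_iff]; omega)]
      refine ⟨?_, by omega, Or.inl rfl⟩
      congr 1
      omega
    rw [hl]
    simp [codeCrosses, pinCode, hc]
    omega
  · have hl : ∃ l, intervalList ε (m + 4) = (ε + m + 2) :: (ε + m + 3) :: (ε + m) :: l := by
      rw [intervalList, if_neg (by omega), intervalList, if_neg (by omega)]
      exact ⟨_, rfl⟩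
    obtain ⟨l, hl⟩ := hl
    have hc : crosses (extendWord u) (ε + m + 2) (ε + m) = false := by
      by_contra hc
      rw [Bool.not_eq_false, crosses_iff (by rw [pinY_lt_iff]; omega)] at hc
      omega
    rw [hl]
    simp [codeCrosses, pinCode, hc]
    omega

theorem ncard_add_ncard_le {α β γ : Type*} {s : Set α} {t : Set β} {r : Set γ} (hr : r.Finite)
    {f : α → γ} {g : β → γ} (hf : Function.Injective f) (hg : Function.Injective g)
    (hfr : ∀ a ∈ s, f a ∈ r) (hgr : ∀ a ∈ t, g a ∈ r) (hne : ∀ a ∈ s, ∀ c ∈ t, f a ≠ g c) :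
    s.ncard + t.ncard ≤ r.ncard := by
  have hfs : f '' s ⊆ r := Set.image_subset_iff.2 hfr
  have hgt : g '' t ⊆ r := Set.image_subset_iff.2 hgr
  rw [← Set.ncard_image_of_injective s hf, ← Set.ncard_image_of_injective t hg,
    ← Set.ncard_union_eq _ (hr.subset hfs) (hr.subset hgt)]
  · exact Set.ncard_le_ncard (Set.union_subset hfs hgt) hr
  · rw [Set.disjoint_left]
    rintro _ ⟨a, ha, rfl⟩ ⟨c, hc, h⟩
    exact hne a ha c hc h.symm

theorem le_ncard_recurrentBlocks (b : ℕ → Bool) {n : ℕ} (hn : 0 < n) :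
    recurrentComplexity b ((n + 1) / 2) ≤ (recurrentBlocks b n).ncard := by
  have h := Set.ncard_le_ncard_of_injOn (factorCode 0 n)
    (fun u hu => factorCode_mem_recurrentBlocks (b := b) hn (fun _ => rfl) hu)
    (factorCode_injective zero_le_one hn).injOn (recurrentBlocks_finite b n)
  rw [← Nat.zero_add n]
  simpa only [recurrentComplexity, Nat.zero_add] using h

theorem add_le_ncard_recurrentBlocks (b : ℕ → Bool) {n : ℕ} (hn : 4 ≤ n) :
    recurrentComplexity b ((n + 1) / 2) + recurrentComplexity b ((n + 2) / 2) ≤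
      (recurrentBlocks b n).ncard := by
  have h := ncard_add_ncard_le (s := recurrentFactors b ((0 + n + 1) / 2))
    (t := recurrentFactors b ((1 + n + 1) / 2)) (recurrentBlocks_finite b n)
    (factorCode_injective (ε := 0) (n := n) zero_le_one (by omega))
    (factorCode_injective (ε := 1) (n := n) le_rfl (by omega))
    (fun u hu => factorCode_mem_recurrentBlocks (by omega) (by omega) hu)
    (fun u hu => factorCode_mem_recurrentBlocks (by omega) (by omega) hu) ?_
  · rw [show 0 + n + 1 = n + 1 by omega, show 1 + n + 1 = n + 2 by omega] at h
    exact h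
  · intro u _ v _ huv
    have h0 := codeCrosses_factorCode hn u
    have h1 := codeCrosses_factorCode hn v
    rw [huv, h1, decide_eq_decide] at h0
    omega

/-- At length three the two starting parities can give equal codes. Keeping, for the odd start, only
words with two equal digits costs at most the two words `01` and `10`, and makes the codes distinct.
-/
theorem le_ncard_recurrentBlocks_three (b : ℕ → Bool) :
    2 * recurrentComplexity b 2 - 2 ≤ (recurrentBlocks b 3).ncard := by
  let t : Set (Fin 2 → Bool) := {u ∈ recurrentFactors b 2 | u 0 = u 1}
  have ht : recurrentComplexity b 2 ≤ t.ncard + 2 := by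
    have hD : ({u | u 0 ≠ u 1} : Set (Fin 2 → Bool)).ncard = 2 := by
      rw [Set.ncard_eq_toFinset_card']
      decide
    have hsub : recurrentFactors b 2 ⊆ t ∪ {u | u 0 ≠ u 1} := by
      intro u hu
      by_cases h : u 0 = u 1
      · exact Or.inl ⟨hu, h⟩
      · exact Or.inr h
    have := (Set.ncard_le_ncard hsub (Set.toFinite _)).trans (Set.ncard_union_le _ _)
    rwa [hD] at this
  have h := ncard_add_ncard_le (s := recurrentFactors b ((0 + 3 + 1) / 2))
    (t := t) (recurrentBlocks_finite b 3)
    (factorCode_injective (ε := 0) (n := 3) zero_le_one (by omega))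
    (factorCode_injective (ε := 1) (n := 3) le_rfl (by omega))
    (fun u hu => factorCode_mem_recurrentBlocks (by omega) (by omega) hu)
    (fun u hu => factorCode_mem_recurrentBlocks (by omega) (by omega) hu.1) ?_
  · have e : (recurrentFactors b ((0 + 3 + 1) / 2)).ncard = recurrentComplexity b 2 := rfl
    omega
  · rintro u - v ⟨-, hv⟩ huv
    -- This bit is pin 2 crossing pin 0 (never) for the even start, and pin 1 crossing pin 2
    -- (exactly when the digits agree) for the odd start.
    have h1 := congrArg (fun w => codeCrosses w 1 0) huv
    have hl0 : intervalList 0 3 = [1, 2, 0] := rfl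
    have hl1 : intervalList 1 3 = [3, 1, 2] := rfl
    simp [factorCode, hl0, hl1, codeCrosses, pinCode, crosses, pinX, extendWord] at h1
    exact h1 hv

/-! ### The growth rate is at least `μ` -/

open Filter Topology

/-- The least values of a recurrent complexity that first exceeds that of a Sturmian word at `N`,
corrected by a linear term to make the generating function simple. -/
noncomputable def excessBound (N k : ℕ) : ℝ :=
  (k + 1) + if N ≤ k then 1 - ((k : ℝ) - N) else 0

theorem hasSum_of_eq {f g : ℕ → ℝ} {a c : ℝ} (h : HasSum f a) (hfg : ∀ k, f k = g k)
    (hac : a = c) : HasSum g c := by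
  rwa [← hac, ← funext hfg]

theorem hasSum_excessBound (N : ℕ) {y : ℝ} (hy0 : 0 ≤ y) (hy1 : y < 1) :
    HasSum (fun k => excessBound N k * y ^ k)
      (1 / (1 - y) ^ 2 + y ^ N * (1 - 2 * y) / (1 - y) ^ 2) := by
  have hn : ‖y‖ < 1 := by rwa [Real.norm_of_nonneg hy0]
  have h1 : (1 - y) ≠ 0 := by linarith
  have hg := hasSum_geometric_of_norm_lt_one hn
  have hk := hasSum_coe_mul_geometric_of_norm_lt_one hn
  have ha : HasSum (fun k : ℕ => ((k : ℝ) + 1) * y ^ k) (1 / (1 - y) ^ 2) := by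
    refine hasSum_of_eq (hk.add hg) (fun k => ?_) ?_
    · ring
    · field_simp
      ring
  have hb : HasSum (fun k : ℕ => (if N ≤ k then 1 - ((k : ℝ) - N) else 0) * y ^ k)
      (y ^ N * (1 - 2 * y) / (1 - y) ^ 2) := by
    rw [← hasSum_nat_add_iff' N, Finset.sum_eq_zero, sub_zero]
    · refine hasSum_of_eq ((hg.sub hk).mul_left (y ^ N)) (fun k => ?_) ?_
      · simp
        ring
      · field_simp
        ring
    · intro i hi
      simp [Finset.mem_range.1 hi]
  refine hasSum_of_eq (ha.add hb) (fun k => ?_) rfl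
  rw [excessBound]
  ring

/-- With `y = x ^ 2`, the terms in `excessBound N (k + 2)` form the tail of the series from index 2.
Those in `excessBound N (k + 3)` form the tail from index 3 times `(1 + 2 * x) / x ^ 2`. -/
theorem hasSum_blockBound (N : ℕ) {x : ℝ} (hx0 : 0 < x) (hx1 : x < 1) :
    HasSum (fun k => (excessBound N (k + 2) + excessBound N (k + 3)) * x ^ (2 * k + 4) +
        (2 * excessBound N (k + 3)) * x ^ (2 * k + 5))
      ((1 / (1 - x ^ 2) ^ 2 + (x ^ 2) ^ N * (1 - 2 * x ^ 2) / (1 - x ^ 2) ^ 2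
          - (excessBound N 0 + excessBound N 1 * x ^ 2)) +
        (1 + 2 * x) / x ^ 2 *
          (1 / (1 - x ^ 2) ^ 2 + (x ^ 2) ^ N * (1 - 2 * x ^ 2) / (1 - x ^ 2) ^ 2
            - (excessBound N 0 + excessBound N 1 * x ^ 2 + excessBound N 2 * x ^ 4))) := by
  have h := hasSum_excessBound N (y := x ^ 2) (by positivity) (by nlinarith)
  have h2 := (hasSum_nat_add_iff' 2).2 h
  have h3 := ((hasSum_nat_add_iff' 3).2 h).mul_left ((1 + 2 * x) / x ^ 2)
  refine hasSum_of_eq (h2.add h3) (fun k => ?_) ?_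
  · field_simp
    ring
  · simp only [Finset.sum_range_succ, Finset.sum_range_zero]
    ring

/-- The Sturmian part is `1` minus a multiple of the polynomial in `hx`, hence exactly `1`. What
remains is the contribution of the excess, which is positive because `x` is small. -/
theorem one_lt_blockBound {N : ℕ} (hN : 2 ≤ N) {x : ℝ} (hx0 : 0 < x) (hx1 : x ≤ 1 / 3)
    (hx : 1 - 4 * x + 3 * x ^ 2 - 2 * x ^ 3 - x ^ 4 + 2 * x ^ 5 = 0) :
    1 < 2 * x + 2 * x ^ 2 + (2 * excessBound N 2 - 2) * x ^ 3 +
      ((1 / (1 - x ^ 2) ^ 2 + (x ^ 2) ^ N * (1 - 2 * x ^ 2) / (1 - x ^ 2) ^ 2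
          - (excessBound N 0 + excessBound N 1 * x ^ 2)) +
        (1 + 2 * x) / x ^ 2 *
          (1 / (1 - x ^ 2) ^ 2 + (x ^ 2) ^ N * (1 - 2 * x ^ 2) / (1 - x ^ 2) ^ 2
            - (excessBound N 0 + excessBound N 1 * x ^ 2 + excessBound N 2 * x ^ 4))) := by
  have hx2 : 1 - 2 * x ^ 2 > 0 := by nlinarith
  have h1 : 1 - x > 0 := by linarith
  have h1' : 1 + x > 0 := by linarith
  have h12 : 1 - x ^ 2 = (1 - x) * (1 + x) := by ring
  have e0 : excessBound N 0 = 1 := by simp [excessBound]; omega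
  have e1 : excessBound N 1 = 2 := by
    rw [excessBound, if_neg (by omega)]
    norm_num
  rw [e0, e1, h12]
  set δ := (x ^ 2) ^ N * (1 - 2 * x ^ 2) / ((1 - x) * (1 + x)) ^ 2 with hδ
  have hδ0 : 0 < δ := by positivity
  have hbase : 2 * x + 2 * x ^ 2 + 4 * x ^ 3 + ((1 / ((1 - x) * (1 + x)) ^ 2 - (1 + 2 * x ^ 2)) +
      (1 + 2 * x) / x ^ 2 * (1 / ((1 - x) * (1 + x)) ^ 2 - (1 + 2 * x ^ 2 + 3 * x ^ 4))) = 1 := by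
    have : 2 * x + 2 * x ^ 2 + 4 * x ^ 3 + ((1 / ((1 - x) * (1 + x)) ^ 2 - (1 + 2 * x ^ 2)) +
      (1 + 2 * x) / x ^ 2 * (1 / ((1 - x) * (1 + x)) ^ 2 - (1 + 2 * x ^ 2 + 3 * x ^ 4))) =
      1 - (1 - 4 * x + 3 * x ^ 2 - 2 * x ^ 3 - x ^ 4 + 2 * x ^ 5) / (1 - x) ^ 2 := by
      field_simp
      ring
    rw [this, hx]
    simp
  -- The factor is `(1 + x) ^ 2 / x ^ 2`, which cancels `(1 + x) ^ 2` in the denominator of `δ`.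
  have hδ' : δ * (1 + (1 + 2 * x) / x ^ 2) = (x ^ 2) ^ N * (1 - 2 * x ^ 2) / (x ^ 2 * (1 - x) ^ 2) := by
    rw [hδ]
    field_simp
    ring
  clear_value δ
  rcases hN.eq_or_lt with rfl | hN
  -- For `N = 2` the value at 2 changes as well: blocks of size three gain `2 * x ^ 3`, while the
  -- tail from index 3 loses a further `(1 + 2 * x) * x ^ 2`. The net loss `x ^ 2` is outweighed by
  -- the excess.
  · have e2 : excessBound 2 2 = 4 := by norm_num [excessBound]
    have hδ2 : δ * (1 + (1 + 2 * x) / x ^ 2) - x ^ 2 = x ^ 2 * (x * (2 - 3 * x)) / (1 - x) ^ 2 := by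
      rw [hδ']
      field_simp
      ring
    have hpos : 0 < x ^ 2 * (x * (2 - 3 * x)) / (1 - x) ^ 2 := by
      have : 0 < 2 - 3 * x := by linarith
      positivity
    have hdiv : (1 + 2 * x) / x ^ 2 * x ^ 4 = (1 + 2 * x) * x ^ 2 := by
      field_simp
    rw [e2]
    linear_combination hpos - hbase - hδ2 + hdiv
  · have e2 : excessBound N 2 = 3 := by
      rw [excessBound, if_neg (by omega)]
      norm_num
    have hpos : 0 < δ * (1 + (1 + 2 * x) / x ^ 2) := by positivity
    rw [e2]
    linear_combination hpos - hbase

/-- The generating polynomial of sufficiently many blocks reaches `1` at `1 / μ`. -/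
theorem exists_one_le_sum_blocks {q B : ℕ → ℕ} {N : ℕ} (hN : 2 ≤ N) (hq : ∀ n < N, n + 1 ≤ q n)
    (hq' : ∀ n, N ≤ n → N + 2 ≤ q n) (h1 : 2 ≤ B 1) (h2 : 2 ≤ B 2) (h3 : 2 * q 2 - 2 ≤ B 3)
    (h4 : ∀ n, 4 ≤ n → q ((n + 1) / 2) + q ((n + 2) / 2) ≤ B n) {x : ℝ} (hx0 : 0 < x)
    (hx1 : x ≤ 1 / 3) (hx : 1 - 4 * x + 3 * x ^ 2 - 2 * x ^ 3 - x ^ 4 + 2 * x ^ 5 = 0) :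
    ∃ L, 1 ≤ ∑ i ∈ Finset.range L, (B (i + 1) : ℝ) * x ^ (i + 1) := by
  have hqe : ∀ k, excessBound N k ≤ q k := by
    intro k
    unfold excessBound
    split_ifs with hk
    -- From `N` on, the correction turns `k + 1` into the constant `N + 2`.
    · have : ((N + 2 : ℕ) : ℝ) ≤ q k := by exact_mod_cast hq' k hk
      push_cast at this
      linarith
    · have : ((k + 1 : ℕ) : ℝ) ≤ q k := by exact_mod_cast hq k (by omega)
      push_cast at this
      linarith
  have hsum := (hasSum_blockBound N hx0 (by linarith)).tendsto_sum_nat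
  have hlt := one_lt_blockBound hN hx0 hx1 hx
  obtain ⟨M, hM⟩ := (hsum.eventually (eventually_gt_nhds (sub_lt_iff_lt_add'.2 hlt))).exists
  -- Block sizes 1, 2, 3, followed by `M` pairs of sizes `2 * k + 4` and `2 * k + 5`.
  refine ⟨2 * M + 3, ?_⟩
  have hpow : ∀ n, 0 ≤ x ^ n := fun n => by positivity
  have hle : ∀ M, 2 * x + 2 * x ^ 2 + (2 * excessBound N 2 - 2) * x ^ 3 +
      ∑ k ∈ Finset.range M, ((excessBound N (k + 2) + excessBound N (k + 3)) * x ^ (2 * k + 4) +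
        (2 * excessBound N (k + 3)) * x ^ (2 * k + 5)) ≤
      ∑ i ∈ Finset.range (2 * M + 3), (B (i + 1) : ℝ) * x ^ (i + 1) := by
    intro M
    induction M with
    | zero =>
      have h1' : (2 : ℝ) ≤ B 1 := by exact_mod_cast h1
      have h2' : (2 : ℝ) ≤ B 2 := by exact_mod_cast h2
      have h3' : 2 * excessBound N 2 - 2 ≤ B 3 := by
        have := hqe 2
        have h3'' : (2 * q 2 : ℝ) ≤ B 3 + 2 := by
          exact_mod_cast (show 2 * q 2 ≤ B 3 + 2 by omega)
        linarith
      have hx' := mul_le_mul_of_nonneg_right h1' (hpow 1)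
      have hx2' := mul_le_mul_of_nonneg_right h2' (hpow 2)
      have hx3' := mul_le_mul_of_nonneg_right h3' (hpow 3)
      simp only [Finset.sum_range_succ, Finset.sum_range_zero, mul_zero, zero_add, Nat.reduceAdd]
      linarith
    | succ M ih =>
      have ha : excessBound N (M + 2) + excessBound N (M + 3) ≤ B (2 * M + 3 + 1) := by
        have := h4 (2 * M + 4) (by omega)
        rw [show (2 * M + 4 + 1) / 2 = M + 2 by omega,
          show (2 * M + 4 + 2) / 2 = M + 3 by omega] at this
        have h' : (q (M + 2) + q (M + 3) : ℝ) ≤ B (2 * M + 4) := by exact_mod_cast this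
        have := hqe (M + 2)
        have := hqe (M + 3)
        linarith
      have hb : 2 * excessBound N (M + 3) ≤ B (2 * M + 3 + 1 + 1) := by
        have := h4 (2 * M + 5) (by omega)
        rw [show (2 * M + 5 + 1) / 2 = M + 3 by omega,
          show (2 * M + 5 + 2) / 2 = M + 3 by omega] at this
        have h' : (q (M + 3) + q (M + 3) : ℝ) ≤ B (2 * M + 5) := by exact_mod_cast this
        have := hqe (M + 3)
        linarith
      have ha' := mul_le_mul_of_nonneg_right ha (hpow (2 * M + 4))
      have hb' := mul_le_mul_of_nonneg_right hb (hpow (2 * M + 5))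
      rw [show 2 * (M + 1) + 3 = 2 * M + 3 + 1 + 1 by ring, Finset.sum_range_succ,
        Finset.sum_range_succ, Finset.sum_range_succ]
      linarith
  linarith [hle M]

theorem exists_mul_pow_le {r B : ℕ → ℕ} (hr0 : 0 < r 0) (hB : 0 < B 1)
    (hrec : ∀ n, ∑ i ∈ Finset.range n, B (i + 1) * r (n - (i + 1)) ≤ r n) {z : ℝ} (hz : 1 ≤ z)
    {L : ℕ} (hL : 1 ≤ ∑ i ∈ Finset.range L, (B (i + 1) : ℝ) * z⁻¹ ^ (i + 1)) :
    ∃ c : ℝ, 0 < c ∧ ∀ n, c * z ^ n ≤ r n := by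
  have hz0 : 0 < z := by linarith
  have hpos : ∀ n, 0 < r n := by
    intro n
    induction n with
    | zero => exact hr0
    | succ n ih =>
      refine lt_of_lt_of_le (Nat.mul_pos hB ih) (le_trans ?_ (hrec (n + 1)))
      exact Finset.single_le_sum (f := fun i => B (i + 1) * r (n + 1 - (i + 1)))
        (fun _ _ => Nat.zero_le _) (Finset.mem_range.2 (Nat.succ_pos n))
  -- With this constant the bound is at most 1 for `n ≤ L`, where `r n ≥ 1` suffices. Beyond `L` the
  -- recurrence reproduces it, because the first `L` block terms sum to at least 1.
  refine ⟨(z ^ L)⁻¹, by positivity, fun n => ?_⟩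
  induction n using Nat.strong_induction_on with
  | _ n ih =>
    rcases le_total n L with hn | hn
    · have h1 : z ^ n ≤ z ^ L := pow_le_pow_right₀ hz hn
      have h2 : (1 : ℝ) ≤ r n := by exact_mod_cast hpos n
      refine le_trans ?_ h2
      rw [inv_mul_le_iff₀ (by positivity)]
      linarith
    · have h1 : (∑ i ∈ Finset.range n, (B (i + 1) : ℝ) * r (n - (i + 1))) ≤ r n := by
        exact_mod_cast hrec n
      calc (z ^ L)⁻¹ * z ^ n
          ≤ (z ^ L)⁻¹ * z ^ n * ∑ i ∈ Finset.range L, (B (i + 1) : ℝ) * z⁻¹ ^ (i + 1) :=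
            le_mul_of_one_le_right (by positivity) hL
        _ = ∑ i ∈ Finset.range L, (B (i + 1) : ℝ) * ((z ^ L)⁻¹ * z ^ (n - (i + 1))) := by
            rw [Finset.mul_sum]
            refine Finset.sum_congr rfl fun i hi => ?_
            have hi' := Finset.mem_range.1 hi
            rw [pow_sub₀ z hz0.ne' (by omega : i + 1 ≤ n), inv_pow]
            ring
        _ ≤ ∑ i ∈ Finset.range L, (B (i + 1) : ℝ) * r (n - (i + 1)) := by
            refine Finset.sum_le_sum fun i hi => ?_
            have hi' := Finset.mem_range.1 hi
            exact mul_le_mul_of_nonneg_left (ih _ (by omega)) (Nat.cast_nonneg _)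
        _ ≤ ∑ i ∈ Finset.range n, (B (i + 1) : ℝ) * r (n - (i + 1)) :=
            Finset.sum_le_sum_of_subset_of_nonneg (Finset.range_subset_range.2 hn)
              fun _ _ _ => by positivity
        _ ≤ r n := h1

theorem three_le_mu : 3 ≤ mu := by
  have hc : ContinuousOn
      (fun z : ℝ => z ^ 5 - 4 * z ^ 4 + 3 * z ^ 3 - 2 * z ^ 2 - z + 2) (Set.Icc 3 4) := by
    fun_prop
  obtain ⟨z, hz3, hz⟩ := intermediate_value_Icc (by norm_num) hc
    (show (0 : ℝ) ∈ Set.Icc _ _ by constructor <;> norm_num)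
  exact hz3.1.trans (mu_isGreatest.2 hz)

theorem inv_mu_root : 1 - 4 * mu⁻¹ + 3 * mu⁻¹ ^ 2 - 2 * mu⁻¹ ^ 3 - mu⁻¹ ^ 4 + 2 * mu⁻¹ ^ 5 = 0 := by
  have h0 : mu ≠ 0 := by linarith [three_le_mu]
  have h : mu ^ 5 - 4 * mu ^ 4 + 3 * mu ^ 3 - 2 * mu ^ 2 - mu + 2 = 0 := mu_isGreatest.1
  field_simp
  linarith

theorem exists_mul_mu_pow_le (b : ℕ → Bool) (hb : ∃ n, recurrentComplexity b n > n + 1) :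
    ∃ c : ℝ, 0 < c ∧ ∀ n, c * mu ^ n ≤ (pinClass (phi b) n).ncard := by
  obtain ⟨N, hN, hq, hq'⟩ := exists_first_excess b hb
  have h3 := three_le_mu
  have hq1 : 2 ≤ recurrentComplexity b 1 := hq 1 (by omega)
  have hB1 : 2 ≤ (recurrentBlocks b 1).ncard := hq1.trans (le_ncard_recurrentBlocks b one_pos)
  obtain ⟨L, hL⟩ := exists_one_le_sum_blocks (B := fun n => (recurrentBlocks b n).ncard) hN hq hq'
    hB1 (hq1.trans (le_ncard_recurrentBlocks b two_pos)) (le_ncard_recurrentBlocks_three b)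
    (fun n hn => add_le_ncard_recurrentBlocks b hn) (x := mu⁻¹) (by positivity)
    (by rw [one_div]; exact inv_anti₀ (by norm_num) h3) inv_mu_root
  obtain ⟨c, hc, h⟩ := exists_mul_pow_le (r := fun n => (recurrentCodes b n).ncard)
    (B := fun n => (recurrentBlocks b n).ncard) (recurrentCodes_zero_pos b)
    (show 0 < (recurrentBlocks b 1).ncard by omega)
    (sum_le_ncard_recurrentCodes b) (by linarith) hL
  refine ⟨c, hc, fun n => (h n).trans ?_⟩
  rw [ncard_pinClass]
  exact_mod_cast Set.ncard_le_ncard (recurrentCodes_subset b n) (codes_finite b n)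

end PinClasses

theorem proposition6p2 (b : ℕ → Bool)
    (hb : ∃ n : ℕ, PinClasses.recurrentComplexity b n > n + 1) :
    ∃ g : ℝ,
      PinClasses.HasGrowthRate (fun n => (PinClasses.pinClass (PinClasses.phi b) n).ncard) g ∧
        g ≥ PinClasses.mu := by
  obtain ⟨g, hg⟩ := PinClasses.exists_hasGrowthRate_pinClass b
  obtain ⟨c, hc, h⟩ := PinClasses.exists_mul_mu_pow_le b hb
  exact ⟨g, hg, hg.le_of_pow_le hc (by linarith [PinClasses.three_le_mu]) h⟩
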